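/- Let $\mathbb{S}^1=\mathbb{R}/\mathbb{Z}$, let $l_1,l_2,l_3,l_4>0$ be real numbers with $l_1+l_2+l_3+l_4=1$, put $a_0=0$ and $a_i=l_1+\dots+l_i$ for $1\le i\le 4$, and let $\tau\in\mathbb{S}^1$. Let $F:\mathbb{S}^1\to\mathbb{S}^1$ be the fully flipped $4$-interval exchange transformation of the circle with trivial permutation, that is, the bijection which flips each interval $[a_{i-1},a_i)$ and then rotates the circle by $\tau$: \[ F(x)=-x+a_{i-1}+a_i+\tau \pmod 1\qquad\text{for } x\in[a_{i-1},a_i),\quad i=1,2,3,4 . \] If $F$ is minimal, i.e. if for every $x\in\mathbb{S}^1$ the orbit $\{F^k(x): k\in\mathbb{Z}\}$ is dense in $\mathbb{S}^1$, then $\tau=\tfrac12$ in $\mathbb{R}/\mathbb{Z}$. -/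

import Mathlib

/-- For lengths `l 0, …, l (n - 1)`, the cut point `a_i = l 0 + … + l (i - 1)`; so `a_0 = 0`, and
`a_n` is the total length. -/
noncomputable def cutPoint {n : ℕ} (l : Fin n → ℝ) (i : ℕ) : ℝ :=
  ∑ j ∈ Finset.univ.filter (fun j : Fin n => (j : ℕ) < i), l j

/-- `F` is the fully flipped `n`-interval exchange transformation with trivial permutation on the
circle `ℝ / ℤ`, with lengths `l` and parameter `τ`: the circle is cut at the points
`a_0 = 0, a_1, …, a_n = 1 = a_0`, each interval `[a_i, a_(i+1))` is flipped
(`x ↦ a_i + a_(i+1) - x`), and then the whole circle is rotated by `τ`.  The intervals cover the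
circle, so `l` and `τ` determine `F`; the half-open images tile the circle, so `F` is a
bijection. -/
structure IsFullyFlippedCircleExchange {n : ℕ} (l : Fin n → ℝ) (τ : UnitAddCircle)
    (F : UnitAddCircle → UnitAddCircle) : Prop where
  length_pos : ∀ i, 0 < l i
  sum_length : ∑ i, l i = 1
  map_eq : ∀ (i : Fin n) (x : ℝ), x ∈ Set.Ico (cutPoint l i) (cutPoint l (i + 1)) →
    F (x : UnitAddCircle) = ((cutPoint l i + cutPoint l (i + 1) - x : ℝ) : UnitAddCircle) + τ

/-- The (two-sided) orbit of `x` under `F`: all forward images of `x`, and all points that have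
`x` as a forward image.  For bijective `F` this is `{F ^ k x | k ∈ ℤ}`. -/
def twoSidedOrbit {X : Type*} (F : X → X) (x : X) : Set X :=
  {y | ∃ k : ℕ, F^[k] x = y ∨ F^[k] y = x}

/-- `F` is minimal: every orbit is dense. -/
def IsMinimalMap {X : Type*} [TopologicalSpace X] (F : X → X) : Prop :=
  ∀ x, Dense (twoSidedOrbit F x)

/-! Represent `τ` by `t ∈ [0, 1)`. If `t ≠ 1/2`, a nonempty finite set equal to its own preimage
under `F` is produced, which minimality forbids. A fixed point would already be such a set, and this
gives `l i ≤ t` and `l i < 1 - t`.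

Let `S` be the arc `[-t, 0]` if `t < 1/2` and its complement if `t > 1/2`, and let `s < 1/2` be its
length. Take the phases in `S` with a parity as vertices, and join `(r, k)` to `(r + l_k, k + 1)`,
with `k` modulo 2 in the parity. For fixed `x`, the cut points `a_m` with `a_m - x` in `S` form a
path in this graph, whose ends are read off from `x` and from its preimage. A finite vertex set
closed under adjacency therefore yields a finite invariant set (`not_isClosedVertexSet_negArc` and
its complement version).

Such a vertex set exists by counting. Vertices have total measure `2s`, edges at most `∑ (s - l i) =
4s - 1 < 2s`. Since the lengths add up to `1`, the graph unfolds onto part of the square grid;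
averaging over large boxes gives a box with more vertices than edges touching them, hence a finite
closed piece (`exists_finite_closed_of_measure`). At `t = 1/2` the two bounds agree. -/

open MeasureTheory

/-! ### Counting vertices and edges over the square grid -/

/-- If every nonempty subset of a finite vertex set `B` has an edge leaving it, then at least
`B.card` edges touch `B`. -/
theorem card_le_card_of_forall_exists_edge {V : Type*} [DecidableEq V] (r : V → V → Prop)
    (B : Finset V) (E : Finset (Sym2 V))
    (h : ∀ C ⊆ B, C.Nonempty → ∃ v ∈ C, ∃ w ∉ C, r v w)
    (hE : ∀ v ∈ B, ∀ w, r v w → s(v, w) ∈ E) : B.card ≤ E.card := by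
  induction hn : B.card generalizing B E with
  | zero => exact Nat.zero_le _
  | succ n ih =>
    obtain ⟨v, hv, w, hw, hr⟩ := h B subset_rfl (Finset.card_pos.mp (by omega))
    have hmem := hE v hv w hr
    -- Since `w` is outside `B`, the chosen edge meets `B` only in `v`. No remaining vertex needs
    -- it, so both counts drop by one.
    have := ih (B.erase v) (E.erase s(v, w))
      (fun C hC hne => h C (hC.trans (Finset.erase_subset _ _)) hne)
      (fun v' hv' w' hr' => by
        rw [Finset.mem_erase] at hv' ⊢
        refine ⟨fun he => ?_, hE v' hv'.2 w' hr'⟩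
        rcases Sym2.eq_iff.mp he with ⟨h1, -⟩ | ⟨h1, -⟩
        · exact hv'.1 h1
        · exact hw (h1 ▸ hv'.2))
      (by rw [Finset.card_erase_of_mem hv]; omega)
    rw [Finset.card_erase_of_mem hmem] at this
    have := Finset.card_pos.mpr ⟨_, hmem⟩
    omega

/-- The steps from an even vertex of the square grid to its four odd neighbours. -/
noncomputable def gridStep (k : Fin 4) : ℤ × ℤ := ![(0, 0), (1, 0), (1, 1), (0, 1)] k

/-- The phase of a vertex of the square grid. -/
noncomputable def gridPhase {G : Type*} [AddCommGroup G] (δ : Fin 4 → G) : (ℤ × ℤ) ⊕ (ℤ × ℤ) → G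
  | .inl u => u.1 • (δ 0 - δ 1) + u.2 • (δ 0 - δ 3)
  | .inr u => u.1 • (δ 0 - δ 1) + u.2 • (δ 0 - δ 3) + δ 0

/-- The relation `hδ` says that the phase changes around a square face cancel, so the phase is a
well-defined function on the grid. -/
theorem gridPhase_step {G : Type*} [AddCommGroup G] (δ : Fin 4 → G) (hδ : δ 0 + δ 2 = δ 1 + δ 3)
    (u : ℤ × ℤ) (k : Fin 4) :
    gridPhase δ (.inr (u - gridStep k)) = gridPhase δ (.inl u) + δ k := by
  have h2 : δ 2 = δ 1 + δ 3 - δ 0 := by rw [← hδ]; abel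
  fin_cases k <;> simp [gridPhase, gridStep, sub_smul, h2] <;> abel

/-- The finite box of grid vertices with coordinates in `[0, N)`. -/
noncomputable def gridBox (N : ℕ) : Finset ((ℤ × ℤ) ⊕ (ℤ × ℤ)) :=
  (Finset.Ico (0 : ℤ) N ×ˢ Finset.Ico (0 : ℤ) N).disjSum
    (Finset.Ico (0 : ℤ) N ×ˢ Finset.Ico (0 : ℤ) N)

/-- Indices of a family of edges that contains every edge touching `gridBox N`. -/
noncomputable def gridEdges (N : ℕ) : Finset ((ℤ × ℤ) × Fin 4) :=
  (Finset.Icc (0 : ℤ) N ×ˢ Finset.Icc (0 : ℤ) N) ×ˢ Finset.univ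

open Classical in
/-- If more grid vertices of the box than edges touching the box have their phases in `S`, then
there is a finite set of phases in `S` that is closed under adjacency. -/
theorem exists_finite_closed_of_card_lt {G : Type*} [AddCommGroup G] (δ : Fin 4 → G)
    (hδ : δ 0 + δ 2 = δ 1 + δ 3) (S : Set G) (N : ℕ) (x : G)
    (hlt : ((gridEdges N).filter (fun e => gridPhase δ (.inl e.1) + x ∈ S ∧
        gridPhase δ (.inl e.1) + x + δ e.2 ∈ S)).card <
      ((gridBox N).filter (fun v => gridPhase δ v + x ∈ S)).card) :
    ∃ C₀ C₁ : Set G, C₀.Finite ∧ C₁.Finite ∧ C₀ ⊆ S ∧ C₁ ⊆ S ∧ (C₀ ∪ C₁).Nonempty ∧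
      ∀ k, ∀ y ∈ S, y + δ k ∈ S → (y ∈ C₀ ↔ y + δ k ∈ C₁) := by
  set B := (gridBox N).filter (fun v => gridPhase δ v + x ∈ S) with hB
  set A := (gridEdges N).filter (fun e => gridPhase δ (.inl e.1) + x ∈ S ∧
        gridPhase δ (.inl e.1) + x + δ e.2 ∈ S) with hA
  have hstep : ∀ u k, gridPhase δ (.inr (u - gridStep k)) + x = gridPhase δ (.inl u) + x + δ k :=
    fun u k => by rw [gridPhase_step δ hδ]; abel
  let r : (ℤ × ℤ) ⊕ (ℤ × ℤ) → (ℤ × ℤ) ⊕ (ℤ × ℤ) → Prop := fun v w => ∃ u k,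
    gridPhase δ (.inl u) + x ∈ S ∧ gridPhase δ (.inl u) + x + δ k ∈ S ∧
      (v = .inl u ∧ w = .inr (u - gridStep k) ∨ v = .inr (u - gridStep k) ∧ w = .inl u)
  have key : ∃ C ⊆ B, C.Nonempty ∧ ∀ v ∈ C, ∀ w, r v w → w ∈ C := by
    by_contra hcon
    push Not at hcon
    have h1 := card_le_card_of_forall_exists_edge r B
      (A.image (fun e => s(.inl e.1, .inr (e.1 - gridStep e.2))))
      (fun C hC hne => by
        obtain ⟨v, hv, w, hr, hw⟩ := hcon C hC hne
        exact ⟨v, hv, w, hw, hr⟩)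
      (by
        rintro v hv w ⟨u, k, hu, hk, h⟩
        rw [Finset.mem_image]
        refine ⟨(u, k), ?_, ?_⟩
        · rw [hA, Finset.mem_filter]
          refine ⟨?_, hu, hk⟩
          have hv := (Finset.mem_filter.mp hv).1
          rcases h with ⟨rfl, -⟩ | ⟨rfl, -⟩
          · simp [gridBox, gridEdges] at hv ⊢
            omega
          · simp [gridBox, gridEdges] at hv ⊢
            fin_cases k <;> simp [gridStep] at hv ⊢ <;> omega
        · rcases h with ⟨rfl, rfl⟩ | ⟨rfl, rfl⟩
          · rfl
          · exact Sym2.eq_swap)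
    exact absurd (h1.trans Finset.card_image_le) (not_le.mpr hlt)
  obtain ⟨C, hCB, hne, hC⟩ := key
  have hCS : ∀ v ∈ C, gridPhase δ v + x ∈ S := fun v hv => (Finset.mem_filter.mp (hCB hv)).2
  refine ⟨{y | ∃ u, .inl u ∈ C ∧ gridPhase δ (.inl u) + x = y},
    {y | ∃ u, .inr u ∈ C ∧ gridPhase δ (.inr u) + x = y}, ?_, ?_, ?_, ?_, ?_, ?_⟩
  · refine (C.finite_toSet.image (fun v => gridPhase δ v + x)).subset ?_
    rintro _ ⟨u, hu, rfl⟩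
    exact ⟨_, hu, rfl⟩
  · refine (C.finite_toSet.image (fun v => gridPhase δ v + x)).subset ?_
    rintro _ ⟨u, hu, rfl⟩
    exact ⟨_, hu, rfl⟩
  · rintro _ ⟨u, hu, rfl⟩
    exact hCS _ hu
  · rintro _ ⟨u, hu, rfl⟩
    exact hCS _ hu
  · obtain ⟨v | v, hv⟩ := hne
    · exact ⟨_, .inl ⟨v, hv, rfl⟩⟩
    · exact ⟨_, .inr ⟨v, hv, rfl⟩⟩
  · intro k y hy hyk
    constructor
    · rintro ⟨u, hu, rfl⟩
      exact ⟨u - gridStep k, hC _ hu _ ⟨u, k, hy, hyk, .inl ⟨rfl, rfl⟩⟩, hstep u k⟩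
    -- Any lift of `y + δ k` will do: its neighbour in direction `k` has phase `y` by cancellation.
    · rintro ⟨u, hu, he⟩
      have hs := hstep (u + gridStep k) k
      rw [add_sub_cancel_right, he] at hs
      have hs := add_right_cancel hs
      refine ⟨u + gridStep k, hC _ hu _ ⟨u + gridStep k, k, ?_, ?_, .inr ⟨?_, rfl⟩⟩, hs.symm⟩
      · rwa [← hs]
      · rwa [← hs]
      · rw [add_sub_cancel_right]

/-- In a compact group with invariant probability measure, suppose the phases in `S` carry fewer
edges than vertices.  Then some finite set of phases is closed under adjacency. -/
theorem exists_finite_closed_of_measure {G : Type*} [AddCommGroup G] [MeasurableSpace G]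
    [MeasurableAdd₂ G] (μ : Measure G) [IsProbabilityMeasure μ] [μ.IsAddLeftInvariant]
    (δ : Fin 4 → G) (hδ : δ 0 + δ 2 = δ 1 + δ 3) (S : Set G) (hS : MeasurableSet S)
    (hlt : ∑ k, μ.real (S ∩ {y | y + δ k ∈ S}) < 2 * μ.real S) :
    ∃ C₀ C₁ : Set G, C₀.Finite ∧ C₁.Finite ∧ C₀ ⊆ S ∧ C₁ ⊆ S ∧ (C₀ ∪ C₁).Nonempty ∧
      ∀ k, ∀ y ∈ S, y + δ k ∈ S → (y ∈ C₀ ↔ y + δ k ∈ C₁) := by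
  classical
  by_contra hcon
  have hle : ∀ N x, ((gridBox N).filter (fun v => gridPhase δ v + x ∈ S)).card ≤
      ((gridEdges N).filter (fun e => gridPhase δ (.inl e.1) + x ∈ S ∧
        gridPhase δ (.inl e.1) + x + δ e.2 ∈ S)).card := fun N x => by
    by_contra h
    exact hcon (exists_finite_closed_of_card_lt δ hδ S N x (not_le.mp h))
  set e : ℝ := ∑ k, μ.real (S ∩ {y | y + δ k ∈ S})
  have hmeasE : ∀ k, MeasurableSet (S ∩ {y | y + δ k ∈ S}) := fun k =>
    hS.inter (measurable_add_const (δ k) hS)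
  have hint : ∀ (A : Set G), MeasurableSet A → ∀ c : G,
      Integrable (fun x => A.indicator (1 : G → ℝ) (c + x)) μ ∧
      ∫ x, A.indicator (1 : G → ℝ) (c + x) ∂μ = μ.real A := fun A hA c => by
    have hi : Integrable (A.indicator (1 : G → ℝ)) μ := (integrable_const (1 : ℝ)).indicator hA
    exact ⟨hi.comp_add_left c, by rw [integral_add_left_eq_self, integral_indicator_one hA]⟩
  -- Averaging over the translate `x` turns each vertex into `μ.real S` and each edge into the
  -- overlap of its type. There are `2 * N ^ 2` vertices and `(N + 1) ^ 2` edges of each type.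
  have hineq : ∀ N : ℕ, 2 * (N : ℝ) ^ 2 * μ.real S ≤ ((N : ℝ) + 1) ^ 2 * e := fun N => by
    have h1 : ∫ x, ∑ v ∈ gridBox N, S.indicator (1 : G → ℝ) (gridPhase δ v + x) ∂μ ≤
        ∫ x, ∑ p ∈ gridEdges N, (S ∩ {y | y + δ p.2 ∈ S}).indicator (1 : G → ℝ)
          (gridPhase δ (.inl p.1) + x) ∂μ := by
      refine integral_mono (integrable_finsetSum _ fun v _ => (hint S hS _).1)
        (integrable_finsetSum _ fun p _ => (hint _ (hmeasE p.2) _).1) fun x => ?_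
      have := hle N x
      rw [Finset.card_filter, Finset.card_filter] at this
      simp only [Set.indicator_apply, Set.mem_inter_iff, Set.mem_ofPred_eq, Pi.one_apply]
      exact_mod_cast this
    rw [integral_finsetSum _ fun v _ => (hint S hS _).1,
      integral_finsetSum _ fun p _ => (hint _ (hmeasE p.2) _).1,
      Finset.sum_congr rfl fun (v : (ℤ × ℤ) ⊕ (ℤ × ℤ)) _ => (hint S hS (gridPhase δ v)).2,
      Finset.sum_congr rfl fun (p : (ℤ × ℤ) × Fin 4) _ => (hint _ (hmeasE p.2) (gridPhase δ (.inl p.1))).2] at h1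
    simp only [gridBox, gridEdges, Finset.sum_product, Finset.sum_const, Finset.card_disjSum,
      Finset.card_product, Int.card_Ico, Int.card_Icc, nsmul_eq_mul] at h1
    push_cast at h1
    simp only [sub_zero, Int.toNat_natCast, Int.toNat_natCast_add_one] at h1
    push_cast at h1
    linarith
  have he0 : 0 ≤ e := Finset.sum_nonneg fun k _ => measureReal_nonneg
  -- For `N > 1` one has `(N + 1) ^ 2 < N ^ 2 + 3 * N`, so `N * (2 * μ.real S - e) > 3 * e`
  -- contradicts `hineq`.
  obtain ⟨N, hN⟩ := exists_nat_gt (max 1 (3 * e / (2 * μ.real S - e)))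
  have hN1 : (1 : ℝ) < N := (le_max_left _ _).trans_lt hN
  have hN2 := (le_max_right _ _).trans_lt hN
  rw [div_lt_iff₀ (by linarith)] at hN2
  nlinarith [hineq N]

/-! ### Cut sequences on the line and lifts of the exchange -/

/-- An increasing bi-infinite sequence of cut points of the line, four per period. -/
structure IsCutSequence (a : ℤ → ℝ) : Prop where
  lt_succ : ∀ k, a k < a (k + 1)
  add_four : ∀ k, a (k + 4) = a k + 1

theorem UnitAddCircle.coe_eq_coe_iff {x y : ℝ} :
    (x : UnitAddCircle) = y ↔ ∃ n : ℤ, y = x + n := by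
  rw [← sub_eq_zero, ← AddCircle.coe_sub, AddCircle.coe_eq_zero_iff]
  constructor
  · rintro ⟨n, hn⟩
    exact ⟨-n, by simp at hn ⊢; linarith⟩
  · rintro ⟨n, hn⟩
    exact ⟨-n, by simp; linarith⟩

theorem UnitAddCircle.coe_add_intCast (x : ℝ) (n : ℤ) : ((x + n : ℝ) : UnitAddCircle) = x :=
  (UnitAddCircle.coe_eq_coe_iff.mpr ⟨n, rfl⟩).symm

theorem UnitAddCircle.infinite : Infinite UnitAddCircle := by
  refine Infinite.of_injective (fun n : ℕ => ((1 / (n + 2 : ℝ) : ℝ) : UnitAddCircle)) ?_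
  intro m n h
  have hI : ∀ k : ℕ, (1 / (k + 2 : ℝ) : ℝ) ∈ Set.Ico (0 : ℝ) (0 + 1) := fun k => by
    refine ⟨by positivity, ?_⟩
    rw [zero_add, div_lt_one (by positivity)]
    have : (0 : ℝ) ≤ k := k.cast_nonneg
    linarith
  have := (AddCircle.coe_eq_coe_iff_of_mem_Ico (hI m) (hI n)).mp h
  field_simp at this
  exact_mod_cast (by linarith : (m : ℝ) = n)

/-- The equivalence in `hinv` is needed because orbits are two-sided: preimages of points of `Q`
must stay in `Q` too. -/
theorem isMinimalMap_not_of_finite {X : Type*} [TopologicalSpace X] [T1Space X] [Infinite X]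
    {F : X → X} (hF : IsMinimalMap F) {Q : Set X} (hQ : Q.Finite) (hne : Q.Nonempty)
    (hinv : ∀ y, F y ∈ Q ↔ y ∈ Q) : False := by
  obtain ⟨x, hx⟩ := hne
  have hit : ∀ (k : ℕ) y, F^[k] y ∈ Q ↔ y ∈ Q := fun k => by
    induction k with
    | zero => exact fun y => Iff.rfl
    | succ k ih => exact fun y => by rw [Function.iterate_succ_apply, ih, hinv]
  have hsub : twoSidedOrbit F x ⊆ Q := by
    rintro y ⟨k, rfl | hk⟩
    · exact (hit k x).mpr hx
    · exact (hit k y).mp (hk ▸ hx)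
  have := (hF x).closure_eq
  rw [(hQ.subset hsub).isClosed.closure_eq] at this
  exact Set.infinite_univ (this ▸ hQ.subset hsub)

namespace IsCutSequence

variable {a : ℤ → ℝ} (ha : IsCutSequence a)
include ha

theorem strictMono : StrictMono a := strictMono_int_of_lt_succ ha.lt_succ

theorem add_four_mul (k n : ℤ) : a (k + 4 * n) = a k + n := by
  induction n using Int.induction_on with
  | zero => simp
  | succ n ih =>
    rw [show k + 4 * ((n : ℤ) + 1) = k + 4 * n + 4 by ring, ha.add_four, ih]
    push_cast; ring
  | pred n ih =>
    have := ha.add_four (k + 4 * (-(n : ℤ) - 1))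
    rw [show k + 4 * (-(n : ℤ) - 1) + 4 = k + 4 * (-n) by ring, ih] at this
    push_cast at this ⊢
    linarith

theorem exists_mem_Ico (z : ℝ) : ∃ k, z ∈ Set.Ico (a k) (a (k + 1)) := by
  set n := ⌊z - a 0⌋ with hn
  have h1 := Int.floor_le (z - a 0)
  have h2 := Int.lt_floor_add_one (z - a 0)
  have h3 := ha.add_four_mul 0 n
  have h4 := ha.add_four (0 + 4 * n)
  rw [← hn] at h1 h2
  have e1 : (0 + 4 * n) + 1 + 1 = 0 + 4 * n + 2 := by ring
  have e2 : (0 + 4 * n) + 2 + 1 = 0 + 4 * n + 3 := by ring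
  have e3 : (0 + 4 * n) + 3 + 1 = 0 + 4 * n + 4 := by ring
  by_cases c1 : z < a (0 + 4 * n + 1)
  · exact ⟨0 + 4 * n, by linarith, c1⟩
  by_cases c2 : z < a (0 + 4 * n + 2)
  · exact ⟨0 + 4 * n + 1, not_lt.mp c1, by rwa [e1]⟩
  by_cases c3 : z < a (0 + 4 * n + 3)
  · exact ⟨0 + 4 * n + 2, not_lt.mp c2, by rwa [e2]⟩
  · exact ⟨0 + 4 * n + 3, not_lt.mp c3, by rw [e3]; linarith⟩

/-- The index of the interval between consecutive cut points that contains `z`. -/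
noncomputable def idx (z : ℝ) : ℤ := (ha.exists_mem_Ico z).choose

theorem idx_le (z : ℝ) : a (ha.idx z) ≤ z := (ha.exists_mem_Ico z).choose_spec.1

theorem lt_idx (z : ℝ) : z < a (ha.idx z + 1) := (ha.exists_mem_Ico z).choose_spec.2

theorem idx_eq {z : ℝ} {k : ℤ} (h : z ∈ Set.Ico (a k) (a (k + 1))) : ha.idx z = k := by
  have h1 := ha.strictMono.lt_iff_lt.mp ((ha.idx_le z).trans_lt h.2)
  have h2 := ha.strictMono.lt_iff_lt.mp (h.1.trans_lt (ha.lt_idx z))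
  omega

theorem idx_add_int (z : ℝ) (n : ℤ) : ha.idx (z + n) = ha.idx z + 4 * n := by
  refine ha.idx_eq ⟨?_, ?_⟩
  · rw [ha.add_four_mul]
    linarith [ha.idx_le z]
  · rw [show ha.idx z + 4 * n + 1 = ha.idx z + 1 + 4 * n by ring, ha.add_four_mul]
    linarith [ha.lt_idx z]

theorem finite_range_coe : (Set.range fun k => ((a k : ℝ) : UnitAddCircle)).Finite := by
  refine ((Set.finite_Ico (0 : ℤ) 4).image fun k => ((a k : ℝ) : UnitAddCircle)).subset ?_
  rintro _ ⟨k, rfl⟩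
  refine ⟨k % 4, ⟨Int.emod_nonneg _ (by norm_num), Int.emod_lt_of_pos _ (by norm_num)⟩, ?_⟩
  have := ha.add_four_mul (k % 4) (k / 4)
  rw [Int.emod_add_mul_ediv] at this
  simp only [this, UnitAddCircle.coe_add_intCast]

end IsCutSequence

/-- The lift to the line of the exchange that flips the intervals cut by `a` and rotates by `t`. -/
noncomputable def IsCutSequence.flip {a : ℤ → ℝ} (ha : IsCutSequence a) (t z : ℝ) : ℝ :=
  a (ha.idx z) + a (ha.idx z + 1) - z + t

theorem IsCutSequence.flip_add_int {a : ℤ → ℝ} (ha : IsCutSequence a) (t z : ℝ) (n : ℤ) :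
    ha.flip t (z + n) = ha.flip t z + n := by
  rw [flip, flip, ha.idx_add_int, show ha.idx z + 4 * n + 1 = ha.idx z + 1 + 4 * n by ring,
    ha.add_four_mul, ha.add_four_mul]
  ring

/-! ### Closed vertex sets and paths of cut points -/

/-- A set of vertices (phase and parity) with phases in `S`, closed under the adjacency given by
the sides of the tiles with cut points `a`. -/
structure IsClosedVertexSet (a : ℤ → ℝ) (S : Set UnitAddCircle)
    (C : Set (UnitAddCircle × ZMod 2)) : Prop where
  mem : ∀ c ∈ C, c.1 ∈ S
  step : ∀ (k : ℤ) (r : ℝ), (r : UnitAddCircle) ∈ S →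
    ((r + (a (k + 1) - a k) : ℝ) : UnitAddCircle) ∈ S →
    (((r : UnitAddCircle), (k : ZMod 2)) ∈ C ↔
      (((r + (a (k + 1) - a k) : ℝ) : UnitAddCircle), ((k + 1 : ℤ) : ZMod 2)) ∈ C)

namespace IsClosedVertexSet

variable {a : ℤ → ℝ} {S : Set UnitAddCircle} {C : Set (UnitAddCircle × ZMod 2)} {I : Set ℝ}

/-- Consecutive cut points seen from `x` are adjacent vertices, and order-connectedness of `I` keeps
the whole path inside `S`. -/
theorem mem_iff_of_le (hC : IsClosedVertexSet a S C) (ha : IsCutSequence a) (hI : I.OrdConnected)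
    (hIS : ∀ r ∈ I, (r : UnitAddCircle) ∈ S) (x : ℝ) {m n : ℤ} (hmn : m ≤ n)
    (hm : a m - x ∈ I) (hn : a n - x ∈ I) :
    (((a m - x : ℝ) : UnitAddCircle), (m : ZMod 2)) ∈ C ↔
      (((a n - x : ℝ) : UnitAddCircle), (n : ZMod 2)) ∈ C := by
  induction n, hmn using Int.leInduction with
  | base => rfl
  | succ n hmn ih =>
    have hn' : a n - x ∈ I := hI.out hm hn
      ⟨by linarith [ha.strictMono.monotone hmn], by linarith [ha.lt_succ n]⟩
    have := hC.step n (a n - x) (hIS _ hn')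
    rw [show a n - x + (a (n + 1) - a n) = a (n + 1) - x by ring] at this
    rw [ih hn', this (hIS _ hn)]

/-- The reflected path: side `n` now leads from `q - a (n + 1)` to `q - a n`. Its ends have parities
`n` and `n + 1`, so `q - a m` carries the parity of `m + 1`. -/
theorem sub_mem_iff_of_le (hC : IsClosedVertexSet a S C) (ha : IsCutSequence a)
    (hI : I.OrdConnected) (hIS : ∀ r ∈ I, (r : UnitAddCircle) ∈ S) (q : ℝ) {m n : ℤ} (hmn : m ≤ n)
    (hm : q - a m ∈ I) (hn : q - a n ∈ I) :
    (((q - a m : ℝ) : UnitAddCircle), ((m + 1 : ℤ) : ZMod 2)) ∈ C ↔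
      (((q - a n : ℝ) : UnitAddCircle), ((n + 1 : ℤ) : ZMod 2)) ∈ C := by
  induction n, hmn using Int.leInduction with
  | base => rfl
  | succ n hmn ih =>
    have hn' : q - a n ∈ I := hI.out hn hm
      ⟨by linarith [ha.lt_succ n], by linarith [ha.strictMono.monotone hmn]⟩
    have := hC.step n (q - a (n + 1)) (hIS _ hn)
    rw [show q - a (n + 1) + (a (n + 1) - a n) = q - a n by ring] at this
    rw [ih hn', ← this (hIS _ hn'), show ((n + 1 + 1 : ℤ) : ZMod 2) = (n : ZMod 2) by
      push_cast; rw [add_assoc, show (1 + 1 : ZMod 2) = 0 from rfl, add_zero]]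

end IsClosedVertexSet

theorem intCast_zmod_two_eq {m n : ℤ} (h : Even (m - n)) : (m : ZMod 2) = n := by
  rw [← sub_eq_zero, ← Int.cast_sub]
  exact (ZMod.intCast_zmod_eq_zero_iff_dvd _ 2).mpr h.two_dvd

/-- If the lift `ha.flip t` swaps two periodic sets of reals that are nonempty and finite modulo
one, the exchange is not minimal. -/
theorem not_isMinimalMap_of_swap {a : ℤ → ℝ} (ha : IsCutSequence a) {t : ℝ}
    {F : UnitAddCircle → UnitAddCircle} (hF : ∀ z : ℝ, F z = ((ha.flip t z : ℝ) : UnitAddCircle))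
    (hmin : IsMinimalMap F) (Q₀ Q₁ : Set ℝ)
    (h₀ : ∀ (z : ℝ) (n : ℤ), z + n ∈ Q₀ ↔ z ∈ Q₀)
    (h₁ : ∀ (z : ℝ) (n : ℤ), z + n ∈ Q₁ ↔ z ∈ Q₁)
    (h₀₁ : ∀ z, ha.flip t z ∈ Q₀ ↔ z ∈ Q₁) (h₁₀ : ∀ z, ha.flip t z ∈ Q₁ ↔ z ∈ Q₀)
    (hfin₀ : ((fun z : ℝ => (z : UnitAddCircle)) '' Q₀).Finite)
    (hfin₁ : ((fun z : ℝ => (z : UnitAddCircle)) '' Q₁).Finite) (hne : Q₀.Nonempty) : False := by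
  have := UnitAddCircle.infinite
  have hmem : ∀ z : ℝ, (z : UnitAddCircle) ∈ (fun z : ℝ => (z : UnitAddCircle)) '' (Q₀ ∪ Q₁) ↔
      z ∈ Q₀ ∪ Q₁ := fun z => by
    refine ⟨?_, fun h => ⟨z, h, rfl⟩⟩
    rintro ⟨w, hw, he⟩
    obtain ⟨n, rfl⟩ := UnitAddCircle.coe_eq_coe_iff.mp he
    rwa [Set.mem_union, h₀, h₁]
  refine isMinimalMap_not_of_finite hmin
    (Q := (fun z : ℝ => (z : UnitAddCircle)) '' (Q₀ ∪ Q₁)) ?_ ?_ ?_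
  · rw [Set.image_union]
    exact hfin₀.union hfin₁
  · obtain ⟨z, hz⟩ := hne
    exact ⟨_, z, .inl hz, rfl⟩
  · intro y
    obtain ⟨z, rfl⟩ := QuotientAddGroup.mk_surjective y
    change F (z : UnitAddCircle) ∈ _ ↔ (z : UnitAddCircle) ∈ _
    rw [hF, hmem, hmem, Set.mem_union, Set.mem_union, h₀₁, h₁₀, or_comm]

/-! ### The arc and its complement -/

/-- The arc of the circle from `-t` to `0`. -/
def negArc (t : ℝ) : Set UnitAddCircle := (fun r : ℝ => (r : UnitAddCircle)) '' Set.Icc (-t) 0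

theorem coe_mem_negArc {t r : ℝ} (ht : t < 1) (hr : r ∈ Set.Ioc (-1) 0) :
    (r : UnitAddCircle) ∈ negArc t ↔ -t ≤ r := by
  constructor
  · rintro ⟨s, hs, he⟩
    obtain ⟨n, rfl⟩ := UnitAddCircle.coe_eq_coe_iff.mp he
    have h1 : (-1 : ℝ) < n := by linarith [hr.1, hs.2]
    have h2 : (n : ℝ) < 1 := by linarith [hr.2, hs.1]
    have h1 : -1 < n := by exact_mod_cast h1
    have h2 : n < 1 := by exact_mod_cast h2
    obtain rfl : n = 0 := by omega
    simpa using hs.1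
  · exact fun h => ⟨r, ⟨h, hr.2⟩, rfl⟩

theorem coe_mem_negArc_compl {t r : ℝ} (ht0 : 0 ≤ t) (ht : t < 1) (hr : r ∈ Set.Ioo 0 (1 - t)) :
    (r : UnitAddCircle) ∈ (negArc t)ᶜ := by
  rw [← UnitAddCircle.coe_add_intCast r (-1), Set.mem_compl_iff, coe_mem_negArc ht]
  · push_cast
    linarith [hr.2]
  · push_cast
    exact ⟨by linarith [hr.1], by linarith [hr.2]⟩

theorem exists_mem_Ioo_of_mem_negArc_compl {t : ℝ} (ht0 : 0 ≤ t) {y : UnitAddCircle}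
    (hy : y ∈ (negArc t)ᶜ) : ∃ r ∈ Set.Ioo 0 (1 - t), (r : UnitAddCircle) = y := by
  obtain ⟨r, hr, rfl⟩ := AddCircle.eq_coe_Ico y
  have hr0 : r ≠ 0 := by
    rintro rfl
    exact hy ⟨0, ⟨by linarith, le_rfl⟩, rfl⟩
  refine ⟨r, ⟨lt_of_le_of_ne hr.1 hr0.symm, ?_⟩, rfl⟩
  by_contra! h
  refine hy ⟨r - 1, ⟨by linarith, by linarith [hr.2]⟩, ?_⟩
  have := UnitAddCircle.coe_add_intCast r (-1)
  push_cast at this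
  exact this

theorem coe_sub_add_int_eq (x y : ℝ) (n : ℤ) :
    ((x + n - (y + n) : ℝ) : UnitAddCircle) = ((x - y : ℝ) : UnitAddCircle) := by
  rw [add_sub_add_right_eq_sub]

/-- A point is recovered modulo one from a vertex and a cut point, and there are finitely many of
each. -/
theorem finite_image_of_sub_mem {A : Set UnitAddCircle} (hA : A.Finite)
    {C : Set (UnitAddCircle × ZMod 2)} (hC : C.Finite) (Q : Set ℝ)
    (h : ∀ z ∈ Q, ∃ c ∈ C, ∃ α ∈ A, (z : UnitAddCircle) = α - c.1 ∨ (z : UnitAddCircle) = α + c.1) :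
    ((fun z : ℝ => (z : UnitAddCircle)) '' Q).Finite := by
  refine ((Set.Finite.image2 (fun α c => α - c.1) hA hC).union
    (Set.Finite.image2 (fun α c => α + c.1) hA hC)).subset ?_
  rintro _ ⟨z, hz, rfl⟩
  obtain ⟨c, hc, α, hα, h | h⟩ := h z hz
  · exact .inl ⟨α, hα, c, hc, h.symm⟩
  · exact .inr ⟨α, hα, c, hc, h.symm⟩

theorem exists_intCast_zmod_two_eq (p : ZMod 2) : ∃ k : ℤ, (k : ZMod 2) = p :=
  ZMod.intCast_surjective p

/-! ### From finite closed vertex sets to finite invariant sets -/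

section

variable {a : ℤ → ℝ} (ha : IsCutSequence a) {t : ℝ}
  {F : UnitAddCircle → UnitAddCircle} (hF : ∀ z : ℝ, F z = ((ha.flip t z : ℝ) : UnitAddCircle))
  (hmin : IsMinimalMap F) {C : Set (UnitAddCircle × ZMod 2)} (hfin : C.Finite) (hne : C.Nonempty)
include ha hF hmin hfin hne

/-- With `x` the image of `z`, the cut points in `[x - t, x]` run from index `idx z + 1` to `idx x`.
The direct and reflected paths through them show that the flip swaps the two sets below. The arc is
closed because a cut point may coincide with `x` or `x - t`. -/
theorem not_isClosedVertexSet_negArc (hlt : ∀ k, a (k + 1) - a k ≤ t)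
    (hC : IsClosedVertexSet a (negArc t) C) : False := by
  have hIS : ∀ r ∈ Set.Icc (-t) 0, (r : UnitAddCircle) ∈ negArc t := fun r hr => ⟨r, hr, rfl⟩
  refine not_isMinimalMap_of_swap ha hF hmin
    {z | (((a (ha.idx z) - z : ℝ) : UnitAddCircle), (ha.idx z : ZMod 2)) ∈ C}
    {z | (((z - t - a (ha.idx z) : ℝ) : UnitAddCircle), ((ha.idx z + 1 : ℤ) : ZMod 2)) ∈ C}
    ?_ ?_ ?_ ?_ ?_ ?_ ?_
  · intro z n
    simp only [Set.mem_ofPred_eq]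
    rw [ha.idx_add_int, ha.add_four_mul, coe_sub_add_int_eq,
      intCast_zmod_two_eq (m := ha.idx z + 4 * n) (n := ha.idx z) ⟨2 * n, by ring⟩]
  · intro z n
    simp only [Set.mem_ofPred_eq]
    rw [ha.idx_add_int, ha.add_four_mul, add_sub_right_comm, coe_sub_add_int_eq,
      intCast_zmod_two_eq (m := ha.idx z + 4 * n + 1) (n := ha.idx z + 1) ⟨2 * n, by ring⟩]
  · intro z
    simp only [Set.mem_ofPred_eq]
    set x := ha.flip t z with hx
    have hx' : x = a (ha.idx z) + a (ha.idx z + 1) - z + t := rfl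
    have b1 := ha.idx_le z
    have b2 := ha.lt_idx z
    have b3 := ha.idx_le x
    have b4 := ha.lt_idx x
    have hle : ha.idx z + 1 ≤ ha.idx x := by
      by_contra! hcon
      have := ha.strictMono.monotone (show ha.idx x + 1 ≤ ha.idx z + 1 by omega)
      linarith [hlt (ha.idx z)]
    rw [show z - t - a (ha.idx z) = a (ha.idx z + 1) - x by rw [hx']; ring]
    refine (hC.mem_iff_of_le ha Set.ordConnected_Icc hIS x hle ⟨?_, ?_⟩ ⟨?_, ?_⟩).symm
    · linarith
    · linarith [hlt (ha.idx z)]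
    · linarith [hlt (ha.idx x)]
    · linarith
  · intro z
    simp only [Set.mem_ofPred_eq]
    set x := ha.flip t z with hx
    have hx' : x = a (ha.idx z) + a (ha.idx z + 1) - z + t := rfl
    have b1 := ha.idx_le z
    have b2 := ha.lt_idx z
    have b3 := ha.idx_le x
    have b4 := ha.lt_idx x
    have hle : ha.idx z + 1 ≤ ha.idx x := by
      by_contra! hcon
      have := ha.strictMono.monotone (show ha.idx x ≤ ha.idx z by omega)
      linarith [hlt (ha.idx x)]
    rw [show a (ha.idx z) - z = x - t - a (ha.idx z + 1) by rw [hx']; ring,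
      intCast_zmod_two_eq (m := ha.idx z) (n := ha.idx z + 1 + 1) ⟨-1, by ring⟩]
    refine (hC.sub_mem_iff_of_le ha Set.ordConnected_Icc hIS (x - t) hle ⟨?_, ?_⟩ ⟨?_, ?_⟩).symm
    · linarith [hlt (ha.idx z)]
    · linarith
    · linarith
    · linarith [hlt (ha.idx x)]
  · refine finite_image_of_sub_mem ha.finite_range_coe hfin _ fun z hz =>
      ⟨_, hz, _, ⟨ha.idx z, rfl⟩, .inl ?_⟩
    simp only [← AddCircle.coe_sub]
    congr 1; ring
  · refine finite_image_of_sub_mem (ha.finite_range_coe.image fun α => α + (t : UnitAddCircle)) hfin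
      _ fun z hz => ⟨_, hz, _, ⟨_, ⟨ha.idx z, rfl⟩, rfl⟩, .inr ?_⟩
    simp only [← AddCircle.coe_add]
    congr 1; ring
  · obtain ⟨⟨y, p⟩, hc⟩ := hne
    obtain ⟨r, hr, rfl⟩ := hC.mem _ hc
    obtain ⟨k, rfl⟩ := exists_intCast_zmod_two_eq p
    -- Seen from this point, the cut point `a k` has phase `r`; the path then leads to the last cut
    -- point not beyond it.
    refine ⟨a k - r, ?_⟩
    simp only [Set.mem_ofPred_eq]
    have b3 := ha.idx_le (a k - r)
    have b4 := ha.lt_idx (a k - r)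
    have hle : k ≤ ha.idx (a k - r) := by
      by_contra! hcon
      have := ha.strictMono.monotone (show ha.idx (a k - r) + 1 ≤ k by omega)
      linarith [hr.2]
    refine (hC.mem_iff_of_le ha Set.ordConnected_Icc hIS (a k - r) hle ?_ ⟨?_, ?_⟩).mp ?_
    · rwa [sub_sub_cancel]
    · linarith [hlt (ha.idx (a k - r))]
    · linarith
    · rwa [sub_sub_cancel]

/-- The same argument with the complementary window `(x, x + 1 - t)`, whose cut points run from `idx
x + 1` to `idx z + 4`. It is open because points lie strictly left of the right end of their
interval. -/
theorem not_isClosedVertexSet_negArc_compl (ht0 : 0 ≤ t) (ht1 : t < 1)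
    (hlt' : ∀ k, a (k + 1) - a k < 1 - t) (hC : IsClosedVertexSet a (negArc t)ᶜ C) : False := by
  have hIS : ∀ r ∈ Set.Ioo 0 (1 - t), (r : UnitAddCircle) ∈ (negArc t)ᶜ := fun r hr =>
    coe_mem_negArc_compl ht0 ht1 hr
  refine not_isMinimalMap_of_swap ha hF hmin
    {z | (((a (ha.idx z + 1) - z : ℝ) : UnitAddCircle), ((ha.idx z + 1 : ℤ) : ZMod 2)) ∈ C}
    {z | (((z - t - a (ha.idx z + 1) : ℝ) : UnitAddCircle), (ha.idx z : ZMod 2)) ∈ C}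
    ?_ ?_ ?_ ?_ ?_ ?_ ?_
  · intro z n
    simp only [Set.mem_ofPred_eq]
    rw [ha.idx_add_int, add_right_comm, ha.add_four_mul, coe_sub_add_int_eq,
      intCast_zmod_two_eq (m := ha.idx z + 1 + 4 * n) (n := ha.idx z + 1) ⟨2 * n, by ring⟩]
  · intro z n
    simp only [Set.mem_ofPred_eq]
    rw [ha.idx_add_int, add_right_comm (ha.idx z), ha.add_four_mul, add_sub_right_comm,
      coe_sub_add_int_eq,
      intCast_zmod_two_eq (m := ha.idx z + 4 * n) (n := ha.idx z) ⟨2 * n, by ring⟩]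
  · intro z
    simp only [Set.mem_ofPred_eq]
    set x := ha.flip t z with hx
    have hx' : x = a (ha.idx z) + a (ha.idx z + 1) - z + t := rfl
    have b1 := ha.idx_le z
    have b2 := ha.lt_idx z
    have b3 := ha.idx_le x
    have b4 := ha.lt_idx x
    have b5 := ha.add_four (ha.idx z)
    have hle : ha.idx x + 1 ≤ ha.idx z + 4 := by
      by_contra! hcon
      have := ha.strictMono.monotone (show ha.idx z + 4 ≤ ha.idx x by omega)
      linarith [hlt' (ha.idx z)]
    rw [show z - t - a (ha.idx z + 1) = a (ha.idx z) - x by rw [hx']; ring,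
      ← UnitAddCircle.coe_add_intCast (a (ha.idx z) - x) 1,
      show a (ha.idx z) - x + (1 : ℤ) = a (ha.idx z + 4) - x by rw [b5]; push_cast; ring,
      intCast_zmod_two_eq (m := ha.idx z) (n := ha.idx z + 4) ⟨-2, by ring⟩]
    refine hC.mem_iff_of_le ha Set.ordConnected_Ioo hIS x hle ⟨?_, ?_⟩ ⟨?_, ?_⟩
    · linarith
    · linarith [hlt' (ha.idx x)]
    · linarith [hlt' (ha.idx z)]
    · linarith
  · intro z
    simp only [Set.mem_ofPred_eq]
    set x := ha.flip t z with hx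
    have hx' : x = a (ha.idx z) + a (ha.idx z + 1) - z + t := rfl
    have b1 := ha.idx_le z
    have b2 := ha.lt_idx z
    have b3 := ha.idx_le x
    have b4 := ha.lt_idx x
    have b5 := ha.add_four (ha.idx x - 3)
    rw [show ha.idx x - 3 + 4 = ha.idx x + 1 by ring] at b5
    -- The reflected path uses the window `(x - 1, x - t)`; its first cut point is `a (idx x + 1)`
    -- moved back one period.
    have hle : ha.idx x - 3 ≤ ha.idx z := by
      by_contra! hcon
      have := ha.strictMono.monotone (show ha.idx z + 1 ≤ ha.idx x - 3 by omega)
      linarith [hlt' (ha.idx x)]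
    rw [show a (ha.idx z + 1) - z = x - t - a (ha.idx z) by rw [hx']; ring,
      ← UnitAddCircle.coe_add_intCast (x - t - a (ha.idx x + 1)) 1,
      show x - t - a (ha.idx x + 1) + (1 : ℤ) = x - t - a (ha.idx x - 3) by
        rw [b5]; push_cast; ring,
      intCast_zmod_two_eq (m := ha.idx x) (n := ha.idx x - 3 + 1) ⟨1, by ring⟩]
    refine hC.sub_mem_iff_of_le ha Set.ordConnected_Ioo hIS (x - t) hle ⟨?_, ?_⟩ ⟨?_, ?_⟩
    · linarith [hlt' (ha.idx x)]
    · linarith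
    · linarith
    · linarith [hlt' (ha.idx z)]
  · refine finite_image_of_sub_mem ha.finite_range_coe hfin _ fun z hz =>
      ⟨_, hz, _, ⟨ha.idx z + 1, rfl⟩, .inl ?_⟩
    simp only [← AddCircle.coe_sub]
    congr 1; ring
  · refine finite_image_of_sub_mem (ha.finite_range_coe.image fun α => α + (t : UnitAddCircle)) hfin
      _ fun z hz => ⟨_, hz, _, ⟨_, ⟨ha.idx z + 1, rfl⟩, rfl⟩, .inr ?_⟩
    simp only [← AddCircle.coe_add]
    congr 1; ring
  · obtain ⟨⟨y, p⟩, hc⟩ := hne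
    obtain ⟨r, hr, rfl⟩ := exists_mem_Ioo_of_mem_negArc_compl ht0 (hC.mem _ hc)
    obtain ⟨k, rfl⟩ := exists_intCast_zmod_two_eq p
    refine ⟨a k - r, ?_⟩
    simp only [Set.mem_ofPred_eq]
    have b3 := ha.idx_le (a k - r)
    have b4 := ha.lt_idx (a k - r)
    have hle : ha.idx (a k - r) + 1 ≤ k := by
      by_contra! hcon
      have := ha.strictMono.monotone (show k ≤ ha.idx (a k - r) by omega)
      linarith [hr.1]
    refine (hC.mem_iff_of_le ha Set.ordConnected_Ioo hIS (a k - r) hle ⟨?_, ?_⟩ ?_).mpr ?_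
    · linarith
    · linarith [hlt' (ha.idx (a k - r))]
    · rwa [sub_sub_cancel]
    · rwa [sub_sub_cancel]

end

/-! ### The cut sequence of the given exchange -/

/-- The periodic extension of the cut points to a bi-infinite sequence. -/
noncomputable def cutSequence (l : Fin 4 → ℝ) (k : ℤ) : ℝ :=
  cutPoint l (k % 4).toNat + ((k / 4 : ℤ) : ℝ)

theorem cutSequence_apply (l : Fin 4 → ℝ) (i : Fin 4) (q : ℤ) :
    cutSequence l (i + 4 * q) = cutPoint l i + q := by
  have h1 : ((i : ℤ) + 4 * q) % 4 = i := by omega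
  have h2 : ((i : ℤ) + 4 * q) / 4 = q := by omega
  rw [cutSequence, h1, h2, Int.toNat_natCast]

theorem cutPoint_succ (l : Fin 4 → ℝ) (i : Fin 4) : cutPoint l (i + 1) = cutPoint l i + l i := by
  fin_cases i <;> simp [cutPoint, Finset.sum_filter, Fin.sum_univ_four]

theorem cutSequence_succ {l : Fin 4 → ℝ} (hl : ∑ i, l i = 1) (i : Fin 4) (q : ℤ) :
    cutSequence l (i + 4 * q + 1) = cutPoint l (i + 1) + q := by
  by_cases h : (i : ℕ) + 1 < 4
  · have := cutSequence_apply l ⟨i + 1, h⟩ q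
    rw [show (i : ℤ) + 4 * q + 1 = ((i + 1 : ℕ) : ℤ) + 4 * q by push_cast; ring]
    exact this
  · have h3 : (i : ℕ) = 3 := by omega
    -- The right end of the fourth interval is the first cut point of the next period.
    have := cutSequence_apply l 0 (q + 1)
    rw [h3, show ((3 : ℕ) : ℤ) + 4 * q + 1 = ((0 : Fin 4) : ℕ) + 4 * (q + 1) by
      rw [Fin.val_zero]; push_cast; ring, this]
    rw [Fin.sum_univ_four] at hl
    simp [cutPoint, Fin.sum_univ_four]
    linarith

theorem exists_fin_four_eq (k : ℤ) : ∃ (i : Fin 4) (q : ℤ), k = i + 4 * q :=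
  ⟨⟨(k % 4).toNat, by omega⟩, k / 4, by
    have := Int.emod_nonneg k (show (4 : ℤ) ≠ 0 by norm_num)
    simp only [Int.toNat_of_nonneg this]
    omega⟩

theorem cutSequence_succ_sub {l : Fin 4 → ℝ} (hl : ∑ i, l i = 1) (i : Fin 4) (q : ℤ) :
    cutSequence l (i + 4 * q + 1) - cutSequence l (i + 4 * q) = l i := by
  rw [cutSequence_succ hl, cutSequence_apply, cutPoint_succ]
  ring

theorem isCutSequence_cutSequence {l : Fin 4 → ℝ} (hl : ∑ i, l i = 1) (hpos : ∀ i, 0 < l i) :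
    IsCutSequence (cutSequence l) where
  lt_succ k := by
    obtain ⟨i, q, rfl⟩ := exists_fin_four_eq k
    linarith [cutSequence_succ_sub hl i q, hpos i]
  add_four k := by
    obtain ⟨i, q, rfl⟩ := exists_fin_four_eq k
    rw [show (i : ℤ) + 4 * q + 4 = i + 4 * (q + 1) by ring, cutSequence_apply, cutSequence_apply]
    push_cast
    ring

theorem IsFullyFlippedCircleExchange.apply_coe {l : Fin 4 → ℝ} {t : ℝ}
    {F : UnitAddCircle → UnitAddCircle} (hF : IsFullyFlippedCircleExchange l (t : UnitAddCircle) F)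
    (ha : IsCutSequence (cutSequence l)) (z : ℝ) : F z = ((ha.flip t z : ℝ) : UnitAddCircle) := by
  obtain ⟨i, q, hk⟩ := exists_fin_four_eq (ha.idx z)
  have h1 := ha.idx_le z
  have h2 := ha.lt_idx z
  rw [IsCutSequence.flip]
  rw [hk] at h1 h2 ⊢
  rw [cutSequence_succ hF.sum_length] at h2 ⊢
  rw [cutSequence_apply] at h1 ⊢
  have h := hF.map_eq i (z - q) ⟨by linarith, by linarith⟩
  have hz := UnitAddCircle.coe_add_intCast (z - q) q
  rw [sub_add_cancel] at hz
  rw [hz, h, ← AddCircle.coe_add]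
  exact UnitAddCircle.coe_eq_coe_iff.mpr ⟨q, by ring⟩

/-! ### Fixed points and bounds on the lengths -/

/-- The fixed point has no other preimage: equal lifted values force overlapping image intervals,
hence equal indices, and a flip is injective on its interval. So the singleton is invariant in both
directions. -/
theorem not_isMinimalMap_of_flip_eq {a : ℤ → ℝ} (ha : IsCutSequence a) {t : ℝ}
    {F : UnitAddCircle → UnitAddCircle} (hF : ∀ z : ℝ, F z = ((ha.flip t z : ℝ) : UnitAddCircle))
    (hmin : IsMinimalMap F) {z : ℝ} {n : ℤ} (hz : ha.flip t z = z + n) : False := by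
  have := UnitAddCircle.infinite
  have hfix : F (z : UnitAddCircle) = z := by
    rw [hF, hz, UnitAddCircle.coe_add_intCast]
  refine isMinimalMap_not_of_finite hmin (Set.finite_singleton (z : UnitAddCircle))
    (Set.singleton_nonempty _) fun y => ⟨fun hy => ?_, ?_⟩
  · obtain ⟨w, rfl⟩ := QuotientAddGroup.mk_surjective y
    change F (w : UnitAddCircle) = (z : UnitAddCircle) at hy
    change (w : UnitAddCircle) = z
    rw [← hfix, hF, hF] at hy
    obtain ⟨m, hm⟩ := UnitAddCircle.coe_eq_coe_iff.mp hy
    refine UnitAddCircle.coe_eq_coe_iff.mpr ⟨m, ?_⟩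
    rw [← ha.flip_add_int] at hm
    generalize w + (m : ℝ) = w at hm
    rw [IsCutSequence.flip, IsCutSequence.flip] at hm
    have b1 := ha.idx_le z
    have b2 := ha.lt_idx z
    have b3 := ha.idx_le w
    have b4 := ha.lt_idx w
    have h1 := ha.strictMono.lt_iff_lt.mp (show a (ha.idx z) < a (ha.idx w + 1) by linarith)
    have h2 := ha.strictMono.lt_iff_lt.mp (show a (ha.idx w) < a (ha.idx z + 1) by linarith)
    rw [show ha.idx w = ha.idx z by omega] at hm
    linarith
  · rintro rfl
    exact hfix

/-- A longer interval would contain the solution `z` of `flip t z = z`. Equality is not excluded: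
that solution would be the omitted right endpoint. -/
theorem sub_le_of_isMinimalMap {a : ℤ → ℝ} (ha : IsCutSequence a) {t : ℝ} (ht0 : 0 ≤ t)
    {F : UnitAddCircle → UnitAddCircle} (hF : ∀ z : ℝ, F z = ((ha.flip t z : ℝ) : UnitAddCircle))
    (hmin : IsMinimalMap F) (k : ℤ) : a (k + 1) - a k ≤ t := by
  by_contra! h
  have hidx : ha.idx ((a k + a (k + 1) + t) / 2) = k :=
    ha.idx_eq ⟨by linarith [ha.lt_succ k], by linarith⟩
  refine not_isMinimalMap_of_flip_eq ha hF hmin (z := (a k + a (k + 1) + t) / 2) (n := 0) ?_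
  rw [IsCutSequence.flip, hidx]
  push_cast
  ring

/-- Here the solution of `flip t z = z + 1` is used; in the case of equality it is the left
endpoint, which belongs to the interval, so the bound is strict. -/
theorem sub_lt_of_isMinimalMap {a : ℤ → ℝ} (ha : IsCutSequence a) {t : ℝ} (ht1 : t < 1)
    {F : UnitAddCircle → UnitAddCircle} (hF : ∀ z : ℝ, F z = ((ha.flip t z : ℝ) : UnitAddCircle))
    (hmin : IsMinimalMap F) (k : ℤ) : a (k + 1) - a k < 1 - t := by
  by_contra! h
  have hidx : ha.idx ((a k + a (k + 1) + t - 1) / 2) = k :=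
    ha.idx_eq ⟨by linarith, by linarith [ha.lt_succ k]⟩
  refine not_isMinimalMap_of_flip_eq ha hF hmin (z := (a k + a (k + 1) + t - 1) / 2) (n := 1) ?_
  rw [IsCutSequence.flip, hidx]
  push_cast
  ring

/-! ### Lengths of the arcs and of their overlaps -/

theorem isProbabilityMeasure_unitAddCircle :
    IsProbabilityMeasure (volume : Measure UnitAddCircle) := ⟨UnitAddCircle.measure_univ⟩

theorem measurableSet_negArc (t : ℝ) : MeasurableSet (negArc t) :=
  (isCompact_Icc.image (AddCircle.continuous_mk' 1)).isClosed.measurableSet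

theorem measureReal_eq_of_preimage {A : Set UnitAddCircle} (hA : MeasurableSet A) :
    volume.real A = volume.real ({r : ℝ | (r : UnitAddCircle) ∈ A} ∩ Set.Ioc (-1) 0) := by
  have h := (UnitAddCircle.measurePreserving_mk (-1)).measure_preimage hA.nullMeasurableSet
  rw [Measure.restrict_apply' measurableSet_Ioc, neg_add_cancel] at h
  rw [measureReal_def, measureReal_def, ← h]
  rfl

theorem measureReal_negArc {t : ℝ} (ht0 : 0 ≤ t) (ht1 : t < 1) : volume.real (negArc t) = t := by
  have : {r : ℝ | (r : UnitAddCircle) ∈ negArc t} ∩ Set.Ioc (-1) 0 = Set.Icc (-t) 0 := by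
    ext r
    constructor
    · rintro ⟨h, hr⟩
      exact ⟨(coe_mem_negArc ht1 hr).mp h, hr.2⟩
    · rintro ⟨h1, h2⟩
      exact ⟨⟨r, ⟨h1, h2⟩, rfl⟩, by linarith, h2⟩
  rw [measureReal_eq_of_preimage (measurableSet_negArc t), this, Real.volume_real_Icc]
  simp [ht0]

/-- As `d < 1 - t`, the translated arc cannot wrap around and meet the original from the other side,
so only one interval of overlap remains. -/
theorem measureReal_negArc_inter_le {t d : ℝ} (ht0 : 0 ≤ t) (ht1 : t < 1) (hdt : d ≤ t)
    (hdt' : d < 1 - t) :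
    volume.real (negArc t ∩ {y | y + (d : UnitAddCircle) ∈ negArc t}) ≤ t - d := by
  have hm : MeasurableSet (negArc t ∩ {y | y + (d : UnitAddCircle) ∈ negArc t}) :=
    (measurableSet_negArc t).inter (measurable_add_const _ (measurableSet_negArc t))
  rw [measureReal_eq_of_preimage hm]
  have hsub : {r : ℝ | (r : UnitAddCircle) ∈
      negArc t ∩ {y | y + (d : UnitAddCircle) ∈ negArc t}} ∩ Set.Ioc (-1) 0 ⊆
      Set.Icc (-t) (-d) := by
    rintro r ⟨⟨h1, h2⟩, hr⟩
    refine ⟨(coe_mem_negArc ht1 hr).mp h1, ?_⟩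
    by_contra! h
    refine coe_mem_negArc_compl (t := t) (r := r + d) ht0 ht1 ⟨by linarith, by linarith [hr.2]⟩ ?_
    rw [AddCircle.coe_add]
    exact h2
  refine (measureReal_mono hsub (by simp)).trans ?_
  rw [Real.volume_real_Icc]
  exact max_le (by linarith) (by linarith)

section

variable {G : Type*} [AddCommGroup G] [MeasurableSpace G] [MeasurableAdd₂ G] (μ : Measure G)
  [μ.IsAddLeftInvariant]

theorem measureReal_inter_add_neg (S : Set G) (d : G) :
    μ.real (S ∩ {y | y + -d ∈ S}) = μ.real (S ∩ {y | y + d ∈ S}) := by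
  rw [measureReal_def, measureReal_def, ← measure_preimage_add μ (-d) (S ∩ {y | y + d ∈ S})]
  congr 2
  ext y
  simp [add_comm, and_comm]

/-- Inclusion–exclusion. For the arc of length `t` it turns the overlap bound `t - d` into `(1 - t)
- d`, so both cases have the same form. -/
theorem measureReal_compl_inter [IsProbabilityMeasure μ] {S : Set G} (hS : MeasurableSet S)
    (d : G) : μ.real (Sᶜ ∩ {y | y + d ∈ Sᶜ}) =
      1 - 2 * μ.real S + μ.real (S ∩ {y | y + d ∈ S}) := by
  have hS' : MeasurableSet {y | y + d ∈ S} := measurable_add_const d hS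
  have h1 : μ.real {y | y + d ∈ S} = μ.real S := by
    rw [measureReal_def, measureReal_def, ← measure_preimage_add μ d S]
    congr 2
    ext y
    simp [add_comm]
  have h2 := measureReal_union_add_inter (μ := μ) (s := S) hS'
  have h3 : Sᶜ ∩ {y | y + d ∈ Sᶜ} = (S ∪ {y | y + d ∈ S})ᶜ := by
    rw [Set.compl_union]
    rfl
  rw [h3, probReal_compl_eq_one_sub (hS.union hS')]
  linarith

end

/-! ### Existence of the closed vertex set and conclusion -/

theorem exists_isClosedVertexSet {l : Fin 4 → ℝ} (hl : ∑ i, l i = 1) {S : Set UnitAddCircle}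
    (hS : MeasurableSet S) {s : ℝ} (hs : volume.real S = s) (hs2 : s < 1 / 2)
    (hle : ∀ i, volume.real (S ∩ {y | y + (l i : UnitAddCircle) ∈ S}) ≤ s - l i) :
    ∃ C, C.Finite ∧ C.Nonempty ∧ IsClosedVertexSet (cutSequence l) S C := by
  have := isProbabilityMeasure_unitAddCircle
  have hl4 := hl
  rw [Fin.sum_univ_four] at hl4
  -- All edges are oriented from parity `0` to parity `1`, so odd sides are traversed backwards. The
  -- required relation is then `∑ l i = 1` modulo one.
  let δ : Fin 4 → UnitAddCircle := ![(l 0 : UnitAddCircle), -(l 1 : UnitAddCircle),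
    (l 2 : UnitAddCircle), -(l 3 : UnitAddCircle)]
  have hδ : δ 0 + δ 2 = δ 1 + δ 3 := by
    change (l 0 : UnitAddCircle) + (l 2 : UnitAddCircle) =
      -(l 1 : UnitAddCircle) + -(l 3 : UnitAddCircle)
    rw [← AddCircle.coe_neg, ← AddCircle.coe_neg, ← AddCircle.coe_add, ← AddCircle.coe_add]
    exact UnitAddCircle.coe_eq_coe_iff.mpr ⟨-1, by push_cast; linarith⟩
  obtain ⟨C₀, C₁, hf₀, hf₁, hS₀, hS₁, hne, hstep⟩ :=
    exists_finite_closed_of_measure volume δ hδ S hS (by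
      rw [Fin.sum_univ_four]
      have h1 := measureReal_inter_add_neg volume S (l 1 : UnitAddCircle)
      have h3 := measureReal_inter_add_neg volume S (l 3 : UnitAddCircle)
      simp only [δ, Matrix.cons_val]
      linarith [hle 0, hle 1, hle 2, hle 3])
  refine ⟨C₀ ×ˢ {0} ∪ C₁ ×ˢ {1}, ?_, ?_, ⟨?_, ?_⟩⟩
  · exact (hf₀.prod (Set.finite_singleton _)).union (hf₁.prod (Set.finite_singleton _))
  · obtain ⟨y, hy | hy⟩ := hne
    · exact ⟨(y, 0), .inl ⟨hy, rfl⟩⟩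
    · exact ⟨(y, 1), .inr ⟨hy, rfl⟩⟩
  · rintro c (⟨h, -⟩ | ⟨h, -⟩)
    · exact hS₀ h
    · exact hS₁ h
  · intro k r hr hr'
    obtain ⟨i, q, rfl⟩ := exists_fin_four_eq k
    rw [cutSequence_succ_sub hl] at hr' ⊢
    have even_case : ∀ m : ℤ, Even m → (m : ZMod 2) = 0 ∧ ((m + 1 : ℤ) : ZMod 2) = 1 :=
      fun m hm => ⟨by simpa using intCast_zmod_two_eq (n := 0) (by simpa using hm),
        by simpa using intCast_zmod_two_eq (m := m + 1) (n := 1) (by simpa using hm)⟩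
    have odd_case : ∀ m : ℤ, Odd m → (m : ZMod 2) = 1 ∧ ((m + 1 : ℤ) : ZMod 2) = 0 :=
      fun m hm => ⟨by simpa using intCast_zmod_two_eq (n := 1) (hm.sub_odd odd_one),
        by simpa using intCast_zmod_two_eq (m := m + 1) (n := 0) (by simpa using hm.add_one)⟩
    have h01 : (0 : ZMod 2) ≠ 1 := by decide
    rw [AddCircle.coe_add] at hr' ⊢
    by_cases hi : i = 0 ∨ i = 2
    · obtain ⟨e1, e2⟩ := even_case (i + 4 * q) (by
        rcases hi with rfl | rfl
        · exact ⟨2 * q, by simp; ring⟩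
        · exact ⟨1 + 2 * q, by simp; ring⟩)
      have hd : δ i = l i := by rcases hi with rfl | rfl <;> rfl
      have := hstep i r hr (by rwa [hd])
      rw [hd] at this
      simpa [e1, e2, h01, h01.symm] using this
    · have hi : i = 1 ∨ i = 3 := by omega
      obtain ⟨e1, e2⟩ := odd_case (i + 4 * q) (by
        rcases hi with rfl | rfl
        · exact ⟨2 * q, by simp; ring⟩
        · exact ⟨1 + 2 * q, by simp; ring⟩)
      have hd : δ i = -(l i : UnitAddCircle) := by rcases hi with rfl | rfl <;> rfl
      have := hstep i _ hr' (by rwa [hd, add_neg_cancel_right])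
      rw [hd, add_neg_cancel_right] at this
      simpa [e1, e2, h01, h01.symm] using this.symm

theorem mainTheorem7 (l : Fin 4 → ℝ) (τ : UnitAddCircle) (F : UnitAddCircle → UnitAddCircle)
    (hF : IsFullyFlippedCircleExchange l τ F) (hmin : IsMinimalMap F) :
    τ = ((1 / 2 : ℝ) : UnitAddCircle) := by
  obtain ⟨t, ⟨ht0, ht1⟩, rfl⟩ := AddCircle.eq_coe_Ico τ
  have ha := isCutSequence_cutSequence hF.sum_length hF.length_pos
  have hF' := hF.apply_coe ha
  have hlt := sub_le_of_isMinimalMap ha ht0 hF' hmin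
  have hlt' := sub_lt_of_isMinimalMap ha ht1 hF' hmin
  have hl : ∀ i, l i ≤ t := fun i => cutSequence_succ_sub hF.sum_length i 0 ▸ hlt _
  have hl' : ∀ i, l i < 1 - t := fun i => cutSequence_succ_sub hF.sum_length i 0 ▸ hlt' _
  have := isProbabilityMeasure_unitAddCircle
  have hμ := measureReal_negArc ht0 ht1
  rcases lt_trichotomy t (1 / 2) with h | h | h
  · obtain ⟨C, hfin, hne, hC⟩ := exists_isClosedVertexSet hF.sum_length (measurableSet_negArc t) hμ
      h fun i => measureReal_negArc_inter_le ht0 ht1 (hl i) (hl' i)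
    exact (not_isClosedVertexSet_negArc ha hF' hmin hfin hne hlt hC).elim
  · rw [h]
  · obtain ⟨C, hfin, hne, hC⟩ := exists_isClosedVertexSet hF.sum_length
      (measurableSet_negArc t).compl (s := 1 - t)
      (by rw [probReal_compl_eq_one_sub (measurableSet_negArc t), hμ]) (by linarith) fun i => by
        rw [measureReal_compl_inter volume (measurableSet_negArc t), hμ]
        linarith [measureReal_negArc_inter_le ht0 ht1 (hl i) (hl' i)]
    exact (not_isClosedVertexSet_negArc_compl ha hF' hmin hfin hne ht0 ht1 hlt' hC).elim
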